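/- Let $n\ge 0$ and let $F:\mathbb{R}^n\rightrightarrows\mathbb{R}^n$ be a set-valued map with nonempty, compact, convex values that is upper semicontinuous: for each $x$ and each $\varepsilon>0$ there is a neighborhood $U$ of $x$ with $F(y)\subset F(x)+\varepsilon\mathbb{B}$ for all $y\in U$, where $\mathbb{B}$ is the closed Euclidean unit ball. A solution from $x_o$ to a differential inclusion $\dot x\in G(x)$ is a locally absolutely continuous map $\phi:\operatorname{dom}\phi\to\mathbb{R}^n$ with $\phi(0)=x_o$ and $\dot\phi(t)\in G(\phi(t))$ for almost all $t\in\operatorname{dom}\phi$, where $\operatorname{dom}\phi$ contains $0$ and is of the form $[0,T]$ or $[0,T)$, $0\le T\le+\infty$. Given $X_o,X_u\subset\mathbb{R}^n$, the system $\dot x\in G(x)$ is safe with respect to $(X_o,X_u)$ if every solution $\phi$ starting in $X_o$ satisfies $\phi(t)\notin X_u$ for all $t\in\operatorname{dom}\phi$. A set is forward invariant for the system if every solution starting in it remains in it. For $\varepsilon:\mathbb{R}^n\to\mathbb{R}_{>0}$ consider $$\Sigma:\ \dot x\in F(x),\qquad \Sigma_\varepsilon:\ \dot x\in F(x)+\varepsilon(x)\mathbb{B},\qquad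 \Sigma^s_\varepsilon:\ \dot x\in\operatorname{co}\{F(x+\varepsilon(x)\mathbb{B})\}+\varepsilon(x)\mathbb{B}.$$ $\Sigma$ is robustly safe (respectively, strongly robustly safe) with respect to $(X_o,X_u)$ if there is a continuous $\varepsilon:\mathbb{R}^n\to\mathbb{R}_{>0}$ such that $\Sigma_\varepsilon$ (respectively, $\Sigma^s_\varepsilon$) is safe with respect to $(X_o,X_u)$. Let $B:\mathbb{R}^n\to\mathbb{R}$ be a barrier function candidate with respect to $(X_o,X_u)$, that is, $B>0$ on $X_u$ and $B\le 0$ on $X_o$, and let $K:=\{x\in\mathbb{R}^n: B(x)\le 0\}$, with boundary $\partial K$. For locally Lipschitz $B$, the Clarke generalized gradient is $$\partial_C B(x):=\operatorname{co}\Big\{\lim_{i\to\infty}\nabla B(x_i)\,:\, x_i\to x,\ x_i\notin\Omega\cup\Omega_B\Big\},$$ where $\Omega_B$ is the set of points at which $B$ is not differentiable and $\Omega\subset\mathbb{R}^n$ is any set of Lebesgue measure zero. Then $\Sigma$ is strongly robustly safe with respect to $(X_o,X_u)$ if one of the following conditions holds: (C1) There exists a continuous function $\varepsilon:\mathbb{R}^n\to\mathbb{R}_{>0}$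 such that $K$ is forward invariant for $\Sigma^s_\varepsilon$. (C2) $\Sigma$ is robustly safe with respect to $(X_o,X_u)$ and $F$ is continuous, that is, upper semicontinuous and lower semicontinuous (for each $x$, each $y\in F(x)$ and each sequence $x_i\to x$, there are $y_i\in F(x_i)$ with $y_i\to y$). (C3) $B$ is locally Lipschitz and $\langle\zeta,\eta\rangle<0$ for all $\zeta\in\partial_C B(x)$, all $\eta\in F(x)$ and all $x\in\partial K$. (C4) $B$ is continuously differentiable and $\langle\nabla B(x),\eta\rangle<0$ for all $\eta\in F(x)$ and all $x\in\partial K$. -/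

import Mathlib

open Set Filter MeasureTheory
open scoped Topology Pointwise

namespace DiffIncl

/-- The Euclidean space `ℝⁿ`. -/
abbrev E (n : ℕ) := EuclideanSpace ℝ (Fin n)

/-! ### Set-valued maps -/

/-- Upper semicontinuity of a set-valued map at `x`: for each `ε > 0`, there is a neighborhood of
`x` on which `F y ⊆ F x + ε 𝔹`, with `𝔹` the closed unit ball. -/
def USCAt {n : ℕ} (F : E n → Set (E n)) (x : E n) : Prop :=
  ∀ ε : ℝ, 0 < ε → ∃ U ∈ 𝓝 x, ∀ y ∈ U, F y ⊆ F x + Metric.closedBall (0 : E n) ε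

/-- Lower semicontinuity of a set-valued map at `x`. -/
def LSCAt {n : ℕ} (F : E n → Set (E n)) (x : E n) : Prop :=
  ∀ y ∈ F x, ∀ u : ℕ → E n, Tendsto u atTop (𝓝 x) →
    ∃ v : ℕ → E n, (∀ i, v i ∈ F (u i)) ∧ Tendsto v atTop (𝓝 y)

/-- Continuity of a set-valued map: upper and lower semicontinuity at every point. -/
def SVContinuous {n : ℕ} (F : E n → Set (E n)) : Prop :=
  ∀ x, USCAt F x ∧ LSCAt F x

/-- `F` is upper semicontinuous with nonempty, compact and convex values. -/
structure WellPosed {n : ℕ} (F : E n → Set (E n)) : Prop where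
  usc : ∀ x, USCAt F x
  nonempty : ∀ x, (F x).Nonempty
  isCompact : ∀ x, IsCompact (F x)
  convex : ∀ x, Convex ℝ (F x)

/-! ### Solutions of `ẋ ∈ F x` -/

/-- The admissible domains: `[0, T]` with `0 ≤ T`, `[0, T)` with `0 < T`, and `[0, ∞)`. -/
def IsSolDomain (I : Set ℝ) : Prop :=
  (∃ T : ℝ, 0 ≤ T ∧ I = Icc 0 T) ∨ (∃ T : ℝ, 0 < T ∧ I = Ico 0 T) ∨ I = Ici 0

/-- `φ`, with domain `I`, is a solution to `ẋ ∈ F x` starting from `x₀`. The values of `φ` outside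
`I` are irrelevant. -/
structure IsSolution {n : ℕ} (F : E n → Set (E n)) (x₀ : E n) (I : Set ℝ) (φ : ℝ → E n) :
    Prop where
  dom : IsSolDomain I
  init : φ 0 = x₀
  locallyAC : ∀ a ∈ I, ∀ b ∈ I, AbsolutelyContinuousOnInterval φ a b
  deriv_mem : ∀ᵐ t : ℝ, t ∈ I → ∃ v ∈ F (φ t), HasDerivWithinAt φ v I t

/-! ### Safety notions -/

/-- `ẋ ∈ F x` is safe with respect to `(Xo, Xu)`. -/
def Safe {n : ℕ} (F : E n → Set (E n)) (Xo Xu : Set (E n)) : Prop :=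
  ∀ x₀ ∈ Xo, ∀ (I : Set ℝ) (φ : ℝ → E n), IsSolution F x₀ I φ → ∀ t ∈ I, φ t ∉ Xu

/-- `K` is forward invariant for `ẋ ∈ F x`: the solutions starting from `K` remain in `K`. -/
def ForwardInvariant {n : ℕ} (F : E n → Set (E n)) (K : Set (E n)) : Prop :=
  ∀ x₀ ∈ K, ∀ (I : Set ℝ) (φ : ℝ → E n), IsSolution F x₀ I φ → ∀ t ∈ I, φ t ∈ K

/-- The right-hand side `F x + ε(x) 𝔹` of the perturbed system. -/
def perturb {n : ℕ} (F : E n → Set (E n)) (ε : E n → ℝ) (x : E n) : Set (E n) :=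
  F x + Metric.closedBall (0 : E n) (ε x)

/-- The right-hand side `co {F (x + ε(x) 𝔹)} + ε(x) 𝔹` of the strongly perturbed system. -/
def strongPerturb {n : ℕ} (F : E n → Set (E n)) (ε : E n → ℝ) (x : E n) : Set (E n) :=
  convexHull ℝ (⋃ y ∈ Metric.closedBall x (ε x), F y) + Metric.closedBall (0 : E n) (ε x)

/-- `ẋ ∈ F x` is robustly safe with respect to `(Xo, Xu)`. -/
def RobustlySafe {n : ℕ} (F : E n → Set (E n)) (Xo Xu : Set (E n)) : Prop :=
  ∃ ε : E n → ℝ, Continuous ε ∧ (∀ x, 0 < ε x) ∧ Safe (perturb F ε) Xo Xu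

/-- `ẋ ∈ F x` is strongly robustly safe with respect to `(Xo, Xu)`. -/
def StronglyRobustlySafe {n : ℕ} (F : E n → Set (E n)) (Xo Xu : Set (E n)) : Prop :=
  ∃ ε : E n → ℝ, Continuous ε ∧ (∀ x, 0 < ε x) ∧ Safe (strongPerturb F ε) Xo Xu

/-! ### Barrier functions -/

/-- `B` is a barrier function candidate with respect to `(Xo, Xu)`. -/
structure IsBarrierCandidate {n : ℕ} (B : E n → ℝ) (Xo Xu : Set (E n)) : Prop where
  pos : ∀ x ∈ Xu, 0 < B x
  nonpos : ∀ x ∈ Xo, B x ≤ 0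

/-- The zero-sublevel set of `B`. -/
def sublevel {n : ℕ} (B : E n → ℝ) : Set (E n) := {x | B x ≤ 0}

/-- The Clarke generalized gradient of `B` at `x`, computed from the points of differentiability
of `B` that lie outside the (Lebesgue-null) set `Ω`. For locally Lipschitz `B` it is the same for
all null sets `Ω`. -/
def clarkeGradient {n : ℕ} (Ω : Set (E n)) (B : E n → ℝ) (x : E n) : Set (E n) :=
  convexHull ℝ {ζ | ∃ u : ℕ → E n, Tendsto u atTop (𝓝 x) ∧
    (∀ i, u i ∉ Ω ∧ DifferentiableAt ℝ B (u i)) ∧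
    Tendsto (fun i => gradient B (u i)) atTop (𝓝 ζ)}

end DiffIncl

/-!
Safety is antitone in the right-hand side, and a forward invariant set containing `Xo` and missing
`Xu` certifies safety, so the sublevel set `{B ≤ 0}` being forward invariant for a strongly
perturbed system is enough. The other cases are handled as follows.

*Local to global.* The strong perturbation at `x` depends only on the number `ε x` and grows with
it. Hence a property of `(x, ε x)` which is inherited by smaller radii and can be achieved near
every point with a constant radius can be achieved with a continuous positive `ε`, by a partition of
unity (`exists_continuous_pos`).

*Continuous `F`.* Near `x`, upper and lower semicontinuity put `F z` within a small neighborhood of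
`F x`, and `F x` within a small neighborhood of `F y`. Since `F y` plus a ball is convex, it absorbs
the convex hull of the `F z` as well: the strong perturbation of a small radius is contained in
the plain one of a given radius (`exists_strongPerturb_subset_perturb`).

*Gradient conditions.* Let `x` be a boundary point of `{B ≤ 0}`. If there were nearby gradients of
`B` and nearby, slightly perturbed values of `F` with positive inner product, then compactness would
give in the limit elements of the Clarke gradient at `x` and of `F x` with nonnegative inner product.
So, close to `x`, all velocities `v` of a strong perturbation satisfy `⟪∇B z, v⟫ ≤ 0` for almost all
`z`. By Rademacher and Fubini, `B` is nonincreasing along almost every segment in the direction `v`,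
thus along all of them (`le_of_ae_fderiv_nonpos`, `exists_strongPerturb_descent`). If `φ` is a
solution of the strongly perturbed system, this yields `(B ∘ φ)' ≤ 0` almost everywhere, as long as
`φ` stays close to the boundary; since `B ∘ φ` is absolutely continuous, it cannot become positive
(`forwardInvariant_sublevel`). For continuously differentiable `B`, the Clarke gradient contains
nothing but the gradient.
-/

open scoped NNReal

namespace DiffIncl

/-! ### Monotonicity of absolutely continuous functions -/

theorem absolutelyContinuousOnInterval_comp {X Y : Type*} [PseudoMetricSpace X]
    [PseudoMetricSpace Y] {g : X → Y} {f : ℝ → X} {K : ℝ≥0} {s : Set X} {a b : ℝ}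
    (hg : LipschitzOnWith K g s) (hf : AbsolutelyContinuousOnInterval f a b)
    (hfs : MapsTo f (uIcc a b) s) : AbsolutelyContinuousOnInterval (g ∘ f) a b := by
  rw [absolutelyContinuousOnInterval_iff] at hf ⊢
  intro ε hε
  obtain ⟨δ, hδ, H⟩ := hf (ε / (K + 1)) (by positivity)
  refine ⟨δ, hδ, fun I hI hlen => ?_⟩
  have hsum := H I hI hlen
  have hmem := hI.1
  calc ∑ i ∈ Finset.range I.1, dist ((g ∘ f) (I.2 i).1) ((g ∘ f) (I.2 i).2)
      ≤ ∑ i ∈ Finset.range I.1, (K + 1) * dist (f (I.2 i).1) (f (I.2 i).2) := by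
        refine Finset.sum_le_sum fun i hi => ?_
        have := hg.dist_le_mul _ (hfs (hmem i hi).1) _ (hfs (hmem i hi).2)
        have h0 := dist_nonneg (x := f (I.2 i).1) (y := f (I.2 i).2)
        simp only [Function.comp]
        linarith
    _ = (K + 1) * ∑ i ∈ Finset.range I.1, dist (f (I.2 i).1) (f (I.2 i).2) := by
        rw [Finset.mul_sum]
    _ < (K + 1) * (ε / (K + 1)) := by gcongr
    _ = ε := by field_simp

theorem le_of_ae_deriv_nonpos {f : ℝ → ℝ} {a b : ℝ} (hab : a ≤ b)
    (hf : AbsolutelyContinuousOnInterval f a b)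
    (h : ∀ᵐ t : ℝ, t ∈ Ioo a b → deriv f t ≤ 0) : f b ≤ f a := by
  have h1 := hf.integral_deriv_eq_sub
  have h2 : ∫ t in a..b, deriv f t ≤ 0 := by
    rw [intervalIntegral.integral_of_le hab, integral_Ioc_eq_integral_Ioo]
    refine integral_nonpos_of_ae ?_
    exact (ae_restrict_iff' measurableSet_Ioo).2 h
  linarith

/-! ### Descent along line segments and along curves -/

theorem ae_ae_add_smul {E : Type*} [NormedAddCommGroup E] [NormedSpace ℝ E]
    [FiniteDimensional ℝ E] [MeasurableSpace E] [BorelSpace E] {μ : Measure E}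
    [μ.IsAddHaarMeasure] {p : E → Prop} (h : ∀ᵐ y ∂μ, p y) (v : E) :
    ∀ᵐ y ∂μ, ∀ᵐ t : ℝ, p (y + t • v) := by
  obtain ⟨N, hN, hNm, hN0⟩ := exists_measurable_superset_of_null (show μ {y | ¬ p y} = 0 from h)
  have hm : MeasurableSet {q : E × ℝ | q.1 + q.2 • v ∉ N} := by
    have : Measurable fun q : E × ℝ => q.1 + q.2 • v := by fun_prop
    exact (this hNm).compl
  have key : ∀ᵐ y ∂μ, ∀ᵐ t : ℝ, y + t • v ∉ N := by
    rw [Measure.ae_ae_comm hm]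
    refine Eventually.of_forall fun t => ?_
    exact (measurePreserving_add_right μ (t • v)).quasiMeasurePreserving.ae
      (show ∀ᵐ y ∂μ, y ∉ N from measure_eq_zero_iff_ae_notMem.1 hN0)
  filter_upwards [key] with y hy
  filter_upwards [hy] with t ht
  by_contra hp
  exact ht (hN hp)

/-- A Lipschitz function on an open convex set whose directional derivative is nonpositive at almost
every point does not increase along any segment in that direction, even a segment lying in the
exceptional null set: by Fubini, almost every parallel segment avoids that set almost everywhere. -/
theorem le_of_ae_fderiv_nonpos {E : Type*} [NormedAddCommGroup E] [NormedSpace ℝ E]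
    [FiniteDimensional ℝ E] [MeasurableSpace E] [BorelSpace E] {μ : Measure E}
    [μ.IsAddHaarMeasure] {f : E → ℝ} {K : ℝ≥0} {s : Set E} (hs : IsOpen s)
    (hconv : Convex ℝ s) (hf : LipschitzOnWith K f s) {v : E}
    (h : ∀ᵐ y ∂μ, y ∈ s → DifferentiableAt ℝ f y → fderiv ℝ f y v ≤ 0) {x : E} (hx : x ∈ s)
    (hxv : x + v ∈ s) : f (x + v) ≤ f x := by
  by_contra! hlt
  have good : ∀ᵐ y ∂μ, y ∈ s → DifferentiableAt ℝ f y ∧ fderiv ℝ f y v ≤ 0 := by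
    filter_upwards [h, hf.ae_differentiableWithinAt_of_mem (μ := μ)] with y hy hd hys
    have hdy := (hd hys).differentiableAt (hs.mem_nhds hys)
    exact ⟨hdy, hy hys hdy⟩
  have hadd : ContinuousAt (fun y : E => y + v) x := by fun_prop
  have hxs := hs.mem_nhds hx
  have hxvs := hs.mem_nhds hxv
  have hfx : ContinuousAt f x := hf.continuousOn.continuousAt hxs
  have hfxv : ContinuousAt (fun y => f (y + v)) x :=
    ContinuousAt.comp (f := fun y : E => y + v) (hf.continuousOn.continuousAt hxvs) hadd
  have hnhds : ∀ᶠ y in 𝓝 x, y ∈ s ∧ y + v ∈ s ∧ f y < f (y + v) :=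
    (eventually_mem_set.2 hxs).and ((hadd.eventually hxvs).and (hfx.eventually_lt hfxv hlt))
  obtain ⟨y, hy, hys, hyvs, hylt⟩ :=
    (Measure.dense_of_ae (ae_ae_add_smul good v)).inter_nhds_nonempty hnhds
  refine hylt.not_ge ?_
  have hseg : ∀ t ∈ Icc (0 : ℝ) 1, y + t • v ∈ s := fun t ht => hconv.add_smul_mem hys hyvs ht
  have hlip : LipschitzWith ‖v‖₊ fun t : ℝ => y + t • v := by
    refine LipschitzWith.of_dist_le_mul fun a b => ?_
    rw [dist_add_left, dist_eq_norm, ← sub_smul, norm_smul, mul_comm, dist_eq_norm, coe_nnnorm]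
  have hac : AbsolutelyContinuousOnInterval (fun t : ℝ => f (y + t • v)) 0 1 :=
    absolutelyContinuousOnInterval_comp (f := fun t : ℝ => y + t • v) hf
      (hlip.lipschitzOnWith (s := uIcc 0 1)).absolutelyContinuousOnInterval
      (by rw [uIcc_of_le zero_le_one]; exact hseg)
  have := le_of_ae_deriv_nonpos zero_le_one hac (by
    filter_upwards [hy] with t ht hmem
    obtain ⟨hd, hle⟩ := ht (hseg t (Ioo_subset_Icc_self hmem))
    have hline : HasDerivAt (fun t : ℝ => y + t • v) v t := by
      simpa using! ((hasDerivAt_id t).smul_const v).const_add y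
    exact (hd.hasFDerivAt.comp_hasDerivAt t hline).deriv.trans_le hle)
  simpa using this

/-- The chain rule is not available for `f ∘ φ`, as `f` need not be differentiable anywhere along
`φ`. Since `f` is Lipschitz, `φ` may be replaced by its tangent up to an `o(h)` term, and it is
enough that `f` does not increase along the tangent. -/
theorem deriv_comp_nonpos {E : Type*} [NormedAddCommGroup E] [NormedSpace ℝ E]
    {f : E → ℝ} {K : ℝ≥0} {s : Set E} {φ : ℝ → E} {t : ℝ} {v : E} (hs : s ∈ 𝓝 (φ t))
    (hf : LipschitzOnWith K f s) (hφ : HasDerivAt φ v t) (hfφ : DifferentiableAt ℝ (f ∘ φ) t)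
    (hv : ∀ᶠ h : ℝ in 𝓝[>] 0, f (φ t + h • v) ≤ f (φ t)) : deriv (f ∘ φ) t ≤ 0 := by
  have h1 : Tendsto (fun h : ℝ => h⁻¹ • ((f ∘ φ) (t + h) - (f ∘ φ) t)) (𝓝[>] 0)
      (𝓝 (deriv (f ∘ φ) t)) := hfφ.hasDerivAt.tendsto_slope_zero_right
  have h2 : Tendsto (fun h : ℝ => K * ‖h⁻¹ • (φ (t + h) - φ t) - v‖) (𝓝[>] 0) (𝓝 0) := by
    have := (hφ.tendsto_slope_zero_right.sub_const v).norm.const_mul (K : ℝ)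
    simpa using this
  refine le_of_tendsto_of_tendsto h1 h2 ?_
  have c1 : Tendsto (fun h : ℝ => φ (t + h)) (𝓝[>] 0) (𝓝 (φ t)) := by
    have : ContinuousAt (fun h : ℝ => φ (t + h)) 0 := by
      refine ContinuousAt.comp (f := fun h : ℝ => t + h) (g := φ) ?_ (by fun_prop)
      simpa using hφ.continuousAt
    simpa using this.tendsto.mono_left nhdsWithin_le_nhds
  have c2 : Tendsto (fun h : ℝ => φ t + h • v) (𝓝[>] 0) (𝓝 (φ t)) := by
    have : ContinuousAt (fun h : ℝ => φ t + h • v) 0 := by fun_prop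
    simpa using this.tendsto.mono_left nhdsWithin_le_nhds
  filter_upwards [hv, c1.eventually hs, c2.eventually hs, self_mem_nhdsWithin] with h hh m1 m2 hpos
  have hpos : 0 < h := hpos
  have hd := hf.dist_le_mul _ m1 _ m2
  rw [dist_eq_norm, dist_eq_norm] at hd
  have e : φ (t + h) - (φ t + h • v) = h • (h⁻¹ • (φ (t + h) - φ t) - v) := by
    rw [smul_sub, smul_smul, mul_inv_cancel₀ hpos.ne', one_smul]; abel
  rw [e, norm_smul, Real.norm_of_nonneg hpos.le] at hd
  have := (Real.le_norm_self _).trans hd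
  simp only [Function.comp, smul_eq_mul]
  rw [inv_mul_le_iff₀ hpos]
  linarith

/-! ### Continuous choice of radii -/

/-- Local constant choices of a radius can be merged into a continuous one: the admissible radii at
each point form an interval, so a partition of unity applies. -/
theorem exists_continuous_pos {X : Type*} [TopologicalSpace X] [NormalSpace X]
    [ParacompactSpace X] {P : X → ℝ → Prop}
    (hmono : ∀ x r r', 0 < r' → r' ≤ r → P x r → P x r')
    (hloc : ∀ x, ∃ r > 0, ∀ᶠ y in 𝓝 x, P y r) :
    ∃ ε : X → ℝ, Continuous ε ∧ (∀ x, 0 < ε x) ∧ ∀ x, P x (ε x) := by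
  obtain ⟨g, hg⟩ := exists_continuous_forall_mem_convex_of_local_const
    (t := fun x => {r : ℝ | 0 < r ∧ P x r})
    (fun x => OrdConnected.convex ⟨fun a ha b hb c hc =>
      ⟨ha.1.trans_le hc.1, hmono x b c (ha.1.trans_le hc.1) hc.2 hb.2⟩⟩)
    (fun x => by
      obtain ⟨r, hr, h⟩ := hloc x
      exact ⟨r, h.mono fun y hy => ⟨hr, hy⟩⟩)
  exact ⟨g, g.continuous, fun x => (hg x).1, fun x => (hg x).2⟩

/-! ### Monotonicity in the right-hand side -/

variable {n : ℕ} {F G : E n → Set (E n)}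

theorem IsSolution.mono (hFG : ∀ x, F x ⊆ G x) {x₀ : E n} {I : Set ℝ} {φ : ℝ → E n}
    (h : IsSolution F x₀ I φ) : IsSolution G x₀ I φ where
  dom := h.dom
  init := h.init
  locallyAC := h.locallyAC
  deriv_mem := by
    filter_upwards [h.deriv_mem] with t ht htI
    obtain ⟨v, hv, hd⟩ := ht htI
    exact ⟨v, hFG _ hv, hd⟩

theorem Safe.anti (hFG : ∀ x, F x ⊆ G x) {Xo Xu : Set (E n)} (h : Safe G Xo Xu) :
    Safe F Xo Xu :=
  fun x₀ hx₀ I φ hφ => h x₀ hx₀ I φ (hφ.mono hFG)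

theorem strongPerturb_mono {x : E n} {r r' : ℝ} (h : r ≤ r') :
    strongPerturb F (fun _ => r) x ⊆ strongPerturb F (fun _ => r') x :=
  add_subset_add
    (convexHull_mono (biUnion_subset_biUnion_left (Metric.closedBall_subset_closedBall h)))
    (Metric.closedBall_subset_closedBall h)

theorem ForwardInvariant.safe {B : E n → ℝ} {Xo Xu : Set (E n)}
    (hB : IsBarrierCandidate B Xo Xu) (h : ForwardInvariant F (sublevel B)) : Safe F Xo Xu :=
  fun x₀ hx₀ I φ hφ t ht hu =>
    (h x₀ (hB.nonpos x₀ hx₀) I φ hφ t ht).not_gt (hB.pos _ hu)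

/-! ### Forward invariance of sublevel sets -/

theorem IsSolDomain.subset {I : Set ℝ} (h : IsSolDomain I) {t : ℝ} (ht : t ∈ I) :
    0 ≤ t ∧ Icc 0 t ⊆ I := by
  rcases h with ⟨T, _, rfl⟩ | ⟨T, _, rfl⟩ | rfl
  · exact ⟨ht.1, Icc_subset_Icc_right ht.2⟩
  · exact ⟨ht.1, fun s hs => ⟨hs.1, hs.2.trans_lt ht.2⟩⟩
  · exact ⟨ht, fun s hs => hs.1⟩

theorem IsSolution.ae_hasDerivAt {x₀ : E n} {I : Set ℝ} {φ : ℝ → E n} (h : IsSolution F x₀ I φ)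
    {T : ℝ} (hT : T ∈ I) :
    ∀ᵐ t : ℝ, t ∈ Ioo 0 T → ∃ v ∈ F (φ t), HasDerivAt φ v t := by
  filter_upwards [h.deriv_mem] with t ht htI
  have hsub := (h.dom.subset hT).2
  obtain ⟨v, hv, hd⟩ := ht (hsub (Ioo_subset_Icc_self htI))
  exact ⟨v, hv, hd.hasDerivAt (mem_of_superset (Icc_mem_nhds htI.1 htI.2) hsub)⟩

/-- A sublevel set is forward invariant if, near its boundary, the velocities of the system point in
directions in which `B` does not increase. -/
theorem forwardInvariant_sublevel {B : E n → ℝ} (hB : LocallyLipschitz B) {W : Set (E n)}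
    (hW : IsOpen W) (hfr : frontier (sublevel B) ⊆ W)
    (hG : ∀ x ∈ W, ∀ v ∈ G x, ∀ᶠ h : ℝ in 𝓝[>] 0, B (x + h • v) ≤ B x) :
    ForwardInvariant G (sublevel B) := by
  intro x₀ hx₀ I φ hφ T hT
  obtain ⟨hT0, hTI⟩ := hφ.dom.subset hT
  have h0I : (0 : ℝ) ∈ I := hTI ⟨le_rfl, hT0⟩
  have hac := hφ.locallyAC 0 h0I T hT
  have hcont : ContinuousOn φ (Icc 0 T) := by
    simpa [uIcc_of_le hT0] using hac.continuousOn
  have hK : IsClosed (sublevel B) := isClosed_le hB.continuous continuous_const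
  by_contra hTK
  have hAclosed : IsClosed (Icc 0 T ∩ φ ⁻¹' sublevel B) :=
    hcont.preimage_isClosed_of_isClosed isClosed_Icc hK
  have hAcomp : IsCompact (Icc 0 T ∩ φ ⁻¹' sublevel B) :=
    isCompact_Icc.of_isClosed_subset hAclosed inter_subset_left
  -- `a` is the last time in `[0, T]` at which the solution is in the sublevel set.
  obtain ⟨a, ⟨haI, haK⟩, hmax⟩ := hAcomp.exists_isGreatest
    ⟨0, ⟨le_rfl, hT0⟩, by simpa [hφ.init] using hx₀⟩
  have haT : a < T := haI.2.lt_of_ne (by rintro rfl; exact hTK haK)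
  have hout : ∀ t ∈ Ioc a T, φ t ∉ sublevel B := fun t ht hk =>
    ht.1.not_ge (hmax ⟨⟨haI.1.trans ht.1.le, ht.2⟩, hk⟩)
  have hca : Tendsto φ (𝓝[>] a) (𝓝 (φ a)) := by
    have := (hcont a haI).mono_left (nhdsWithin_mono a (Icc_subset_Icc_left haI.1))
    have := this.mono_left (nhdsWithin_mono a Ioc_subset_Icc_self)
    rwa [nhdsWithin_Ioc_eq_nhdsGT haT] at this
  have hmem : φ a ∈ frontier (sublevel B) := by
    rw [frontier_eq_closure_inter_closure]
    refine ⟨subset_closure haK, mem_closure_of_tendsto hca ?_⟩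
    filter_upwards [Ioc_mem_nhdsGT haT] with t ht using hout t ht
  -- On `[a, b]`, the solution remains in `W` and in a region where `B` is Lipschitz.
  obtain ⟨L, s, hs, hL⟩ := hB (φ a)
  obtain ⟨b, hb, hbs⟩ := mem_nhdsGT_iff_exists_Ioc_subset.1
    (inter_mem (hca (interior_mem_nhds.2 hs))
      (inter_mem (hca (hW.mem_nhds (hfr hmem))) (Ioc_mem_nhdsGT haT)))
  have hb : a < b := hb
  have hbT : b ≤ T := (hbs ⟨hb, le_rfl⟩).2.2.2
  have hbI : b ∈ I := hTI ⟨haI.1.trans hb.le, hbT⟩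
  have hint : ∀ t ∈ Icc a b, φ t ∈ interior s := by
    intro t ht
    rcases ht.1.eq_or_lt with rfl | hlt
    · exact mem_interior_iff_mem_nhds.2 hs
    · exact (hbs ⟨hlt, ht.2⟩).1
  have hcomp : AbsolutelyContinuousOnInterval (B ∘ φ) a b :=
    absolutelyContinuousOnInterval_comp (hL.mono interior_subset)
      (hφ.locallyAC a (hTI haI) b hbI) (by rw [uIcc_of_le hb.le]; exact hint)
  have hle : (B ∘ φ) b ≤ (B ∘ φ) a := by
    refine le_of_ae_deriv_nonpos hb.le hcomp ?_
    filter_upwards [hcomp.ae_differentiableAt, hφ.ae_hasDerivAt hbI] with t hd hv ht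
    obtain ⟨v, hvG, hvd⟩ := hv ⟨haI.1.trans_lt ht.1, ht.2⟩
    have htc := Ioo_subset_Icc_self ht
    exact deriv_comp_nonpos (mem_interior_iff_mem_nhds.1 (hint t htc)) hL hvd
      (hd (by rwa [uIcc_of_le hb.le])) (hG _ (hbs ⟨ht.1, ht.2.le⟩).2.1 v hvG)
  exact hout b ⟨hb, hbT⟩ (hle.trans haK)

/-! ### Strong perturbations of continuous maps -/

theorem LSCAt.eventually_inter_ball_nonempty {x y : E n} (h : LSCAt F x) (hy : y ∈ F x) {ε : ℝ}
    (hε : 0 < ε) : ∀ᶠ z in 𝓝 x, (F z ∩ Metric.ball y ε).Nonempty := by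
  by_contra hc
  obtain ⟨u, hu, hne⟩ := exists_seq_forall_of_frequently (not_eventually.1 hc)
  obtain ⟨v, hvF, hv⟩ := h y hy u hu
  obtain ⟨i, hi⟩ := (hv.eventually (Metric.ball_mem_nhds y hε)).exists
  exact hne i ⟨v i, hvF i, hi⟩

theorem LSCAt.eventually_subset_add_closedBall {x : E n} (h : LSCAt F x) (hc : IsCompact (F x))
    {ε : ℝ} (hε : 0 < ε) :
    ∀ᶠ z in 𝓝 x, F x ⊆ F z + Metric.closedBall (0 : E n) ε := by
  obtain ⟨t, htF, hfin, hcov⟩ := hc.finite_cover_balls (half_pos hε)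
  have hev : ∀ᶠ z in 𝓝 x, ∀ y ∈ t, (F z ∩ Metric.ball y (ε / 2)).Nonempty :=
    (hfin.eventually_all).2 fun y hy =>
      h.eventually_inter_ball_nonempty (htF hy) (half_pos hε)
  filter_upwards [hev] with z hz a ha
  obtain ⟨y, hy, hay⟩ := mem_iUnion₂.1 (hcov ha)
  obtain ⟨w, hwF, hw⟩ := hz y hy
  refine mem_add.2 ⟨w, hwF, a - w, ?_, by abel⟩
  rw [mem_closedBall_zero_iff, ← dist_eq_norm]
  have := dist_triangle_right a w y
  rw [Metric.mem_ball] at hay hw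
  linarith

theorem add_closedBall_add_closedBall (A : Set (E n)) {r s : ℝ} (hr : 0 ≤ r) (hs : 0 ≤ s) :
    A + Metric.closedBall (0 : E n) r + Metric.closedBall (0 : E n) s
      = A + Metric.closedBall (0 : E n) (r + s) := by
  rw [add_assoc, closedBall_add_closedBall hr hs, add_zero]

theorem exists_strongPerturb_subset_perturb (hF : WellPosed F) (hc : SVContinuous F) {x : E n}
    {e : ℝ} (he : 0 < e) :
    ∃ r > 0, ∀ᶠ y in 𝓝 x,
      strongPerturb F (fun _ => r) y ⊆ perturb F (fun _ => e) y := by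
  have he3 : 0 < e / 3 := by positivity
  obtain ⟨U, hU, hUF⟩ := hF.usc x (e / 3) he3
  obtain ⟨r, hr, hrU⟩ := Metric.mem_nhds_iff.1 hU
  refine ⟨min (r / 2) (e / 3), by positivity, ?_⟩
  filter_upwards [(hc x).2.eventually_subset_add_closedBall (hF.isCompact x) he3,
    Metric.ball_mem_nhds x (half_pos hr)] with y hy hyx
  have hunion : (⋃ z ∈ Metric.closedBall y (min (r / 2) (e / 3)), F z)
      ⊆ F y + Metric.closedBall (0 : E n) (e / 3 + e / 3) := by
    refine iUnion₂_subset fun z hz => ?_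
    have hzx : z ∈ Metric.ball x r := by
      have := dist_triangle z y x
      have := (Metric.mem_closedBall.1 hz).trans (min_le_left _ _)
      rw [Metric.mem_ball] at hyx ⊢
      linarith
    rw [← add_closedBall_add_closedBall _ he3.le he3.le]
    exact (hUF z (hrU hzx)).trans (add_subset_add_right hy)
  have hhull := convexHull_min hunion ((hF.convex y).add (convex_closedBall _ _))
  refine (add_subset_add hhull
    (Metric.closedBall_subset_closedBall (min_le_right (r / 2) (e / 3)))).trans ?_
  rw [add_closedBall_add_closedBall _ (by positivity) he3.le]
  exact (congrArg (fun s => F y + Metric.closedBall (0 : E n) s)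
    (show e / 3 + e / 3 + e / 3 = e by ring)).le

theorem RobustlySafe.stronglyRobustlySafe (hF : WellPosed F) (hc : SVContinuous F)
    {Xo Xu : Set (E n)} (h : RobustlySafe F Xo Xu) : StronglyRobustlySafe F Xo Xu := by
  obtain ⟨ε, hεc, hεpos, hsafe⟩ := h
  obtain ⟨δ, hδc, hδpos, hδ⟩ := exists_continuous_pos
    (P := fun x r => strongPerturb F (fun _ => r) x ⊆ perturb F ε x)
    (fun x r r' _ hle h => (strongPerturb_mono hle).trans h) (fun x => by
      obtain ⟨r, hr, hsub⟩ := exists_strongPerturb_subset_perturb hF hc (x := x)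
        (half_pos (hεpos x))
      refine ⟨r, hr, ?_⟩
      -- The radius `ε x / 2` was used at `x` because `ε` may be smaller than `ε x` nearby.
      filter_upwards [hsub, hεc.continuousAt.eventually_const_lt (half_lt_self (hεpos x))]
        with y hy hlt
      exact hy.trans (add_subset_add_left (Metric.closedBall_subset_closedBall hlt.le)))
  exact ⟨δ, hδc, hδpos, hsafe.anti hδ⟩

/-! ### Gradient conditions on the boundary -/

/-- An upper semicontinuous map with closed values has a closed graph. -/
theorem USCAt.mem_of_tendsto {x : E n} (h : USCAt F x) (hc : IsClosed (F x))
    (hne : (F x).Nonempty) {u v : ℕ → E n} {y : E n} (hu : Tendsto u atTop (𝓝 x))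
    (hv : ∀ i, v i ∈ F (u i)) (hvy : Tendsto v atTop (𝓝 y)) : y ∈ F x := by
  rw [hc.mem_iff_infDist_zero hne]
  refine le_antisymm (le_of_forall_pos_le_add fun ε hε => ?_) Metric.infDist_nonneg
  obtain ⟨U, hU, hUF⟩ := h ε hε
  refine le_of_tendsto ((Metric.continuous_infDist_pt (F x)).continuousAt.tendsto.comp hvy) ?_
  filter_upwards [hu hU] with i hi
  obtain ⟨a, ha, b, hb, hab⟩ := mem_add.1 (hUF _ hi (hv i))
  refine (Metric.infDist_le_dist_of_mem ha).trans ?_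
  rw [zero_add, ← hab, dist_eq_norm, add_sub_cancel_left]
  exact mem_closedBall_zero_iff.1 hb

theorem norm_gradient_le {B : E n → ℝ} {K : ℝ≥0} {s : Set (E n)} {z : E n} (hs : s ∈ 𝓝 z)
    (hB : LipschitzOnWith K B s) : ‖gradient B z‖ ≤ K := by
  rw [gradient, LinearIsometryEquiv.norm_map]
  exact norm_fderiv_le_of_lipschitzOn ℝ hs hB

/-- The strict inequality between the Clarke gradient and `F` at one point gives, by compactness,
a weak inequality between the actual gradients and the perturbed values of `F` at nearby points. -/
theorem exists_inner_gradient_nonpos (hF : WellPosed F) {Ω : Set (E n)} {B : E n → ℝ}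
    (hB : LocallyLipschitz B) {x : E n}
    (hx : ∀ η ∈ F x, ∀ ζ ∈ clarkeGradient Ω B x, inner ℝ ζ η < 0) :
    ∃ r > 0, ∀ z ∈ Metric.ball x r, z ∉ Ω → DifferentiableAt ℝ B z →
      ∀ w ∈ Metric.ball x r, ∀ η ∈ F w, ∀ e ∈ Metric.closedBall (0 : E n) r,
        inner ℝ (gradient B z) (η + e) ≤ 0 := by
  by_contra! hcon
  have hpos : ∀ i : ℕ, (0 : ℝ) < 1 / (i + 1) := fun i => Nat.one_div_pos_of_nat
  choose z hz hzΩ hzd w hw η hη e he hlt using fun i : ℕ => hcon (1 / (i + 1)) (hpos i)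
  have hr := tendsto_one_div_add_atTop_nhds_zero_nat (𝕜 := ℝ)
  have hzx : Tendsto z atTop (𝓝 x) := tendsto_iff_dist_tendsto_zero.2
    (squeeze_zero (fun _ => dist_nonneg) (fun i => (hz i).le) hr)
  have hwx : Tendsto w atTop (𝓝 x) := tendsto_iff_dist_tendsto_zero.2
    (squeeze_zero (fun _ => dist_nonneg) (fun i => (hw i).le) hr)
  have he0 : Tendsto e atTop (𝓝 0) := squeeze_zero_norm
    (fun i => mem_closedBall_zero_iff.1 (he i)) hr
  obtain ⟨K, s, hs, hK⟩ := hB x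
  obtain ⟨U, hU, hUF⟩ := hF.usc x 1 one_pos
  have hcomp : IsCompact (Metric.closedBall (0 : E n) K ×ˢ
      (F x + Metric.closedBall (0 : E n) 1)) :=
    (isCompact_closedBall _ _).prod ((hF.isCompact x).add (isCompact_closedBall _ _))
  have hmem : ∀ᶠ i in atTop, (gradient B (z i), η i) ∈ Metric.closedBall (0 : E n) K ×ˢ
      (F x + Metric.closedBall (0 : E n) 1) := by
    filter_upwards [hzx.eventually (eventually_mem_nhds_iff.2 hs), hwx hU] with i hi hwi
    exact ⟨mem_closedBall_zero_iff.2 (norm_gradient_le hi hK), hUF _ hwi (hη i)⟩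
  obtain ⟨⟨ζ, y⟩, -, k, hk, hlim⟩ := hcomp.tendsto_subseq' hmem.frequently
  have hζ : Tendsto (fun i => gradient B (z (k i))) atTop (𝓝 ζ) :=
    (continuous_fst.tendsto _).comp hlim
  have hy : Tendsto (fun i => η (k i)) atTop (𝓝 y) := (continuous_snd.tendsto _).comp hlim
  have hyF : y ∈ F x := (hF.usc x).mem_of_tendsto (hF.isCompact x).isClosed (hF.nonempty x)
    (hwx.comp hk.tendsto_atTop) (fun i => hη (k i)) hy
  have hζB : ζ ∈ clarkeGradient Ω B x := subset_convexHull ℝ _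
    ⟨z ∘ k, hzx.comp hk.tendsto_atTop, fun i => ⟨hzΩ _, hzd _⟩, hζ⟩
  have hinner : Tendsto (fun i => inner ℝ (gradient B (z (k i))) (η (k i) + e (k i))) atTop
      (𝓝 (inner ℝ ζ y)) := by
    simpa using hζ.inner (𝕜 := ℝ) (hy.add (he0.comp hk.tendsto_atTop))
  exact (hx y hyF ζ hζB).not_ge (ge_of_tendsto' hinner fun i => (hlt (k i)).le)

/-- Near a point at which the Clarke gradient condition holds, `B` does not increase in the direction
of any velocity of a strong perturbation with a small constant radius. -/
theorem exists_strongPerturb_descent (hF : WellPosed F) {Ω : Set (E n)} (hΩ : volume Ω = 0)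
    {B : E n → ℝ} (hB : LocallyLipschitz B) {x : E n}
    (hx : ∀ η ∈ F x, ∀ ζ ∈ clarkeGradient Ω B x, inner ℝ ζ η < 0) :
    ∃ r > 0, ∀ᶠ y in 𝓝 x, ∀ v ∈ strongPerturb F (fun _ => r) y,
      ∀ᶠ h : ℝ in 𝓝[>] 0, B (y + h • v) ≤ B y := by
  obtain ⟨r, hr, hdir⟩ := exists_inner_gradient_nonpos hF hB hx
  obtain ⟨K, s, hs, hK⟩ := hB x
  obtain ⟨ρ, hρ, hρs⟩ := Metric.mem_nhds_iff.1 (inter_mem hs (Metric.ball_mem_nhds x hr))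
  refine ⟨r / 2, half_pos hr, ?_⟩
  filter_upwards [Metric.ball_mem_nhds x (half_pos hr), Metric.ball_mem_nhds x hρ]
    with y hyr hyρ v hv
  have hv' : ∀ z ∈ Metric.ball x r, z ∉ Ω → DifferentiableAt ℝ B z →
      inner ℝ (gradient B z) v ≤ 0 := by
    intro z hz hzΩ hzd
    obtain ⟨c, hc, e, he, rfl⟩ := mem_add.1 hv
    -- The inequality defines a half-space, so it passes from the values of `F` to their hull.
    have hconv : Convex ℝ {c : E n | inner ℝ (gradient B z) (c + e) ≤ 0} := by
      intro a ha b hb p q hp hq hpq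
      have hsplit : p • a + q • b + e = p • (a + e) + q • (b + e) := by
        rw [smul_add, smul_add, add_add_add_comm, ← add_smul, hpq, one_smul]
      rw [mem_ofPred_eq, hsplit, inner_add_right, real_inner_smul_right, real_inner_smul_right]
      exact add_nonpos (mul_nonpos_of_nonneg_of_nonpos hp ha)
        (mul_nonpos_of_nonneg_of_nonpos hq hb)
    refine convexHull_min (iUnion₂_subset fun w hw η hη => ?_) hconv hc
    refine hdir z hz hzΩ hzd w ?_ η hη e
      (Metric.closedBall_subset_closedBall (half_le_self hr.le) he)
    have := dist_triangle w y x
    rw [Metric.mem_closedBall] at hw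
    rw [Metric.mem_ball] at hyr ⊢
    linarith
  have hmove : ContinuousAt (fun h : ℝ => y + h • v) 0 := by fun_prop
  have hev : ∀ᶠ h : ℝ in 𝓝[>] 0, y + h • v ∈ Metric.ball x ρ :=
    nhdsWithin_le_nhds (hmove (Metric.isOpen_ball.mem_nhds (by simpa using hyρ)))
  filter_upwards [hev, self_mem_nhdsWithin] with h hh hpos
  refine le_of_ae_fderiv_nonpos (μ := volume) Metric.isOpen_ball (convex_ball x ρ)
    (hK.mono fun z hz => (hρs hz).1) ?_ hyρ hh
  filter_upwards [measure_eq_zero_iff_ae_notMem.1 hΩ] with z hzΩ hz hzd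
  rw [map_smul, ← inner_gradient_left]
  exact mul_nonpos_of_nonneg_of_nonpos (le_of_lt hpos) (hv' z (hρs hz).2 hzΩ hzd)

theorem exists_forwardInvariant_strongPerturb (hF : WellPosed F) {Ω : Set (E n)}
    (hΩ : volume Ω = 0) {B : E n → ℝ} (hB : LocallyLipschitz B)
    (h : ∀ x ∈ frontier (sublevel B), ∀ η ∈ F x, ∀ ζ ∈ clarkeGradient Ω B x,
      inner ℝ ζ η < 0) :
    ∃ ε : E n → ℝ, Continuous ε ∧ (∀ x, 0 < ε x) ∧
      ForwardInvariant (strongPerturb F ε) (sublevel B) := by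
  let D : E n → ℝ → Prop := fun y r => ∀ v ∈ strongPerturb F (fun _ => r) y,
    ∀ᶠ h : ℝ in 𝓝[>] 0, B (y + h • v) ≤ B y
  have hG : IsOpen {x | ∃ r > 0, ∀ᶠ y in 𝓝 x, D y r} := by
    refine isOpen_iff_mem_nhds.2 ?_
    rintro x ⟨r, hr, hD⟩
    filter_upwards [eventually_eventually_nhds.2 hD] with z hz using ⟨r, hr, hz⟩
  -- Radii are constrained only on `closure W`: they need not be bounded below at the boundary of
  -- the open set of points which admit one.
  obtain ⟨W, hW, hfrW, hWG⟩ := normal_exists_closure_subset isClosed_frontier hG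
    fun x hx => exists_strongPerturb_descent hF hΩ hB (h x hx)
  obtain ⟨ε, hεc, hεpos, hε⟩ := exists_continuous_pos
    (P := fun y r => y ∈ closure W → D y r)
    (fun x r r' _ hle h hx v hv => h hx v (strongPerturb_mono hle hv))
    (fun x => by
      by_cases hx : x ∈ closure W
      · obtain ⟨r, hr, hD⟩ := hWG hx
        exact ⟨r, hr, hD.mono fun y hy _ => hy⟩
      · refine ⟨1, one_pos, ?_⟩
        filter_upwards [isClosed_closure.isOpen_compl.mem_nhds hx] with y hy hy'
        exact absurd hy' hy)
  exact ⟨ε, hεc, hεpos, forwardInvariant_sublevel hB hW hfrW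
    fun x hx => hε x (subset_closure hx)⟩

theorem clarkeGradient_subset_singleton {Ω : Set (E n)} {B : E n → ℝ} (hB : ContDiff ℝ 1 B)
    (x : E n) : clarkeGradient Ω B x ⊆ {gradient B x} := by
  refine convexHull_min ?_ (convex_singleton _)
  rintro ζ ⟨u, hu, -, hζ⟩
  have hcont : Continuous (gradient B) :=
    (InnerProductSpace.toDual ℝ (E n)).symm.continuous.comp (hB.continuous_fderiv one_ne_zero)
  exact tendsto_nhds_unique hζ ((hcont.tendsto x).comp hu)

end DiffIncl

theorem theorem1 (n : ℕ) (F : DiffIncl.E n → Set (DiffIncl.E n)) (hF : DiffIncl.WellPosed F)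
    (Xo Xu : Set (DiffIncl.E n)) (B : DiffIncl.E n → ℝ)
    (hB : DiffIncl.IsBarrierCandidate B Xo Xu)
    (Ω : Set (DiffIncl.E n)) (hΩ : volume Ω = 0)
    (h :
      (∃ ε : DiffIncl.E n → ℝ, Continuous ε ∧ (∀ x, 0 < ε x) ∧
        DiffIncl.ForwardInvariant (DiffIncl.strongPerturb F ε) (DiffIncl.sublevel B)) ∨
      (DiffIncl.RobustlySafe F Xo Xu ∧ DiffIncl.SVContinuous F) ∨
      (LocallyLipschitz B ∧ ∀ x ∈ frontier (DiffIncl.sublevel B), ∀ η ∈ F x,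
        ∀ ζ ∈ DiffIncl.clarkeGradient Ω B x, inner ℝ ζ η < 0) ∨
      (ContDiff ℝ 1 B ∧ ∀ x ∈ frontier (DiffIncl.sublevel B), ∀ η ∈ F x,
        inner ℝ (gradient B x) η < 0)) :
    DiffIncl.StronglyRobustlySafe F Xo Xu := by
  have of_invariant : (∃ ε : DiffIncl.E n → ℝ, Continuous ε ∧ (∀ x, 0 < ε x) ∧
      DiffIncl.ForwardInvariant (DiffIncl.strongPerturb F ε) (DiffIncl.sublevel B)) →
      DiffIncl.StronglyRobustlySafe F Xo Xu := fun ⟨ε, hc, hpos, hinv⟩ =>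
    ⟨ε, hc, hpos, hinv.safe hB⟩
  rcases h with h | ⟨hsafe, hcont⟩ | ⟨hlip, h⟩ | ⟨hdiff, h⟩
  · exact of_invariant h
  · exact hsafe.stronglyRobustlySafe hF hcont
  · exact of_invariant (DiffIncl.exists_forwardInvariant_strongPerturb hF hΩ hlip h)
  · refine of_invariant (DiffIncl.exists_forwardInvariant_strongPerturb hF hΩ
      hdiff.locallyLipschitz fun x hx η hη ζ hζ => ?_)
    rw [mem_singleton_iff.1 (DiffIncl.clarkeGradient_subset_singleton hdiff x hζ)]
    exact h x hx η hη
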